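/- For every real number $M$ there is a constant $C>0$, depending only on $M$, such that the following holds. Let $n\ge 1$, let $\Omega\subset\mathbb{R}^n$ be open, and let $V:\mathbb{R}^n\to\mathbb{R}$ be a bounded continuous function with $0\le V(x)\le M$ for all $x\in\mathbb{R}^n$ and $V(x)>0$ for all $x\in\Omega$. All functions are real-valued, $\|\cdot\|$ is the norm of $L^2(\mathbb{R}^n)$, and $\nabla$ is the weak gradient. Let $u_0\in H^1(\mathbb{R}^n)$ and $u_1\in L^2(\mathbb{R}^n)$ satisfy $\operatorname{supp}(u_1+u_0)\subset\overline{\Omega}$ (where the support is the complement of the largest open set on which the function vanishes almost everywhere), $u_1+u_0=0$ almost everywhere on $\partial\Omega$ (which is automatic if $\partial\Omega$ is a null set), and $$L_0^2:=\int_\Omega\frac{|u_1(x)+u_0(x)|^2}{V(x)}\,dx<\infty .$$ Let $u\in C([0,\infty);H^1(\mathbb{R}^n))\cap C^1([0,\infty);L^2(\mathbb{R}^n))$ be the weak solution of $$u_{tt}-\Delta u+V(x)u+u_t=0\quad(t>0,\ x\in\mathbb{R}^n),\qquad u(0,\cdot)=u_0,\quad u_t(0,\cdot)=u_1,$$ that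 is, $u(0)=u_0$, $u_t(0)=u_1$ and, for all $\varphi\in H^1(\mathbb{R}^n)$ and all $t>0$, $$\frac{d}{dt}(u_t(t),\varphi)+(\nabla u(t),\nabla\varphi)+(Vu(t),\varphi)+(u_t(t),\varphi)=0,$$ where $(\cdot,\cdot)$ is the $L^2$ inner product. Put $$E(t):=\frac12\int_{\mathbb{R}^n}\bigl(|u_t(t,x)|^2+|\nabla u(t,x)|^2+V(x)|u(t,x)|^2\bigr)\,dx .$$ Then, for all $t\ge 0$, $$(1+t)^2E(t)\le C\bigl(\|u_0\|^2+\|u_1\|^2+\|\nabla u_0\|^2+L_0^2\bigr),$$ $$(1+t)\,\|u(t,\cdot)\|^2\le C\bigl(\|u_0\|^2+\|u_1\|^2+\|\nabla u_0\|^2+L_0^2\bigr).$$ -/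

import Mathlib

open MeasureTheory Set Topology
open scoped ContDiff BoundedContinuousFunction

noncomputable section

namespace DampedWave

/-- The space `ℝⁿ` with its Euclidean norm. -/
abbrev Space (n : ℕ) : Type := EuclideanSpace ℝ (Fin n)

/-- Real-valued `L²(ℝⁿ)`. -/
abbrev L2 (n : ℕ) : Type := Lp ℝ 2 (volume : Measure (Space n))

/-- `L²(ℝⁿ; ℝⁿ)`, the space of square integrable vector fields. -/
abbrev L2Vec (n : ℕ) : Type := Lp (Space n) 2 (volume : Measure (Space n))

/-- `g` is the weak gradient of `f`:
`∫ f ∂ᵢφ = - ∫ gᵢ φ` for all test functions `φ ∈ C_c^∞(ℝⁿ)` and all `i`. -/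
def IsWeakGradient {n : ℕ} (f : L2 n) (g : L2Vec n) : Prop :=
  ∀ φ : Space n → ℝ, ContDiff ℝ ∞ φ → HasCompactSupport φ → ∀ i : Fin n,
    ∫ x, f x * fderiv ℝ φ x (EuclideanSpace.single i 1) = - ∫ x, g x i * φ x

lemma integrable_coe_mul {n : ℕ} (f : L2 n) {ψ : Space n → ℝ} (hψ : Continuous ψ)
    (hc : HasCompactSupport ψ) : Integrable (fun x => f x * ψ x) :=
  (Lp.memLp f).integrable_mul (q := 2) (hψ.memLp_of_hasCompactSupport hc)

lemma integrable_coord_mul {n : ℕ} (g : L2Vec n) (i : Fin n) {ψ : Space n → ℝ}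
    (hψ : Continuous ψ) (hc : HasCompactSupport ψ) :
    Integrable (fun x => g x i * ψ x) := by
  have h : MemLp (fun x => g x i) 2 (volume : Measure (Space n)) :=
    (EuclideanSpace.proj (𝕜 := ℝ) i : Space n →L[ℝ] ℝ).comp_memLp' (Lp.memLp g)
  exact h.integrable_mul (q := 2) (hψ.memLp_of_hasCompactSupport hc)

lemma continuous_fderiv_apply {n : ℕ} {φ : Space n → ℝ} (hφ : ContDiff ℝ ∞ φ) (e : Space n) :
    Continuous (fun x => fderiv ℝ φ x e) :=
  (hφ.continuous_fderiv (by simp)).clm_apply continuous_const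

/-- The Sobolev space `H¹(ℝⁿ)`: the pairs `(f, ∇f)` of an `f ∈ L²(ℝⁿ)` and its weak gradient
`∇f ∈ L²(ℝⁿ; ℝⁿ)` (which is determined by `f`), with the norm `(‖f‖² + ‖∇f‖²)^{1/2}`. -/
def H1 (n : ℕ) : Submodule ℝ (WithLp 2 (L2 n × L2Vec n)) where
  carrier := {p | IsWeakGradient p.fst p.snd}
  zero_mem' := by
    intro φ hφ hc i
    have h1 : ∀ᵐ x : Space n, (0 : L2 n) x * fderiv ℝ φ x (EuclideanSpace.single i 1) = 0 := by
      filter_upwards [Lp.coeFn_zero ℝ 2 (volume : Measure (Space n))] with x hx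
      rw [hx]
      simp only [Pi.zero_apply, zero_mul]
    have h2 : ∀ᵐ x : Space n, (0 : L2Vec n) x i * φ x = 0 := by
      filter_upwards [Lp.coeFn_zero (Space n) 2 (volume : Measure (Space n))] with x hx
      rw [hx]
      simp only [Pi.zero_apply, PiLp.zero_apply, zero_mul]
    change ∫ x, (0 : L2 n) x * _ = - ∫ x, (0 : L2Vec n) x i * φ x
    rw [integral_eq_zero_of_ae h1, integral_eq_zero_of_ae h2, neg_zero]
  add_mem' := by
    intro p q hp hq φ hφ hc i
    have hd := continuous_fderiv_apply hφ (EuclideanSpace.single i (1 : ℝ))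
    have hdc : HasCompactSupport (fun x => fderiv ℝ φ x (EuclideanSpace.single i (1 : ℝ))) :=
      hc.fderiv_apply ℝ _
    have h1 : ∫ x, (p.fst + q.fst : L2 n) x * fderiv ℝ φ x (EuclideanSpace.single i 1)
        = ∫ x, (p.fst x * fderiv ℝ φ x (EuclideanSpace.single i 1)
          + q.fst x * fderiv ℝ φ x (EuclideanSpace.single i 1)) := by
      apply integral_congr_ae
      filter_upwards [Lp.coeFn_add p.fst q.fst] with x hx
      rw [hx]
      simp only [Pi.add_apply, add_mul]
    have h2 : ∫ x, (p.snd + q.snd : L2Vec n) x i * φ x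
        = ∫ x, (p.snd x i * φ x + q.snd x i * φ x) := by
      apply integral_congr_ae
      filter_upwards [Lp.coeFn_add p.snd q.snd] with x hx
      rw [hx]
      simp only [Pi.add_apply, PiLp.add_apply, add_mul]
    change ∫ x, (p.fst + q.fst : L2 n) x * _ = - ∫ x, (p.snd + q.snd : L2Vec n) x i * φ x
    rw [h1, h2, integral_add (integrable_coe_mul _ hd hdc) (integrable_coe_mul _ hd hdc),
      integral_add (integrable_coord_mul _ i hφ.continuous hc)
        (integrable_coord_mul _ i hφ.continuous hc), hp φ hφ hc i, hq φ hφ hc i]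
    ring
  smul_mem' := by
    intro c p hp φ hφ hc i
    have h1 : ∫ x, (c • p.fst : L2 n) x * fderiv ℝ φ x (EuclideanSpace.single i 1)
        = ∫ x, c * (p.fst x * fderiv ℝ φ x (EuclideanSpace.single i 1)) := by
      apply integral_congr_ae
      filter_upwards [Lp.coeFn_smul c p.fst] with x hx
      rw [hx]
      simp only [Pi.smul_apply, smul_eq_mul, mul_assoc]
    have h2 : ∫ x, (c • p.snd : L2Vec n) x i * φ x = ∫ x, c * (p.snd x i * φ x) := by
      apply integral_congr_ae
      filter_upwards [Lp.coeFn_smul c p.snd] with x hx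
      rw [hx]
      simp only [Pi.smul_apply, PiLp.smul_apply, smul_eq_mul, mul_assoc]
    change ∫ x, (c • p.fst : L2 n) x * _ = - ∫ x, (c • p.snd : L2Vec n) x i * φ x
    rw [h1, h2, integral_const_mul, integral_const_mul, hp φ hφ hc i]
    ring

/-- The function `f ∈ L²(ℝⁿ)` underlying an element of `H¹(ℝⁿ)`. -/
def toL2 {n : ℕ} (f : H1 n) : L2 n := f.1.fst

/-- The weak gradient `∇f ∈ L²(ℝⁿ; ℝⁿ)` of an element `f` of `H¹(ℝⁿ)`. -/
def grad {n : ℕ} (f : H1 n) : L2Vec n := f.1.snd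

/-- The time derivative `u_t(t) ∈ L²(ℝⁿ)` of `u : [0,∞) → L²(ℝⁿ)` (one-sided at `t = 0`).
The values of `u` at negative times play no role. -/
def timeDeriv {n : ℕ} (u : ℝ → H1 n) (t : ℝ) : L2 n :=
  derivWithin (fun s => toL2 (u s)) (Ici 0) t

/-- `u` is a weak solution, in the class `C([0,∞); H¹(ℝⁿ)) ∩ C¹([0,∞); L²(ℝⁿ))`, of
`u_tt - Δu + V u + u_t = 0`, `u(0) = u₀`, `u_t(0) = u₁`. The equation is tested with
`φ ∈ H¹(ℝⁿ)`: for every `t > 0`,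
`d/dt (u_t(t), φ) + (∇u(t), ∇φ) + (V u(t), φ) + (u_t(t), φ) = 0`. -/
structure IsWeakSolution {n : ℕ} (V : Space n →ᵇ ℝ) (u₀ : H1 n) (u₁ : L2 n)
    (u : ℝ → H1 n) : Prop where
  continuousOn : ContinuousOn u (Ici 0)
  contDiffOn : ContDiffOn ℝ 1 (fun t => toL2 (u t)) (Ici 0)
  initial : u 0 = u₀
  initial_deriv : timeDeriv u 0 = u₁
  equation : ∀ φ : H1 n, ∀ t : ℝ, 0 < t →
    HasDerivAt (fun s => inner ℝ (timeDeriv u s) (toL2 φ))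
      (-(inner ℝ (grad (u t)) (grad φ) + (∫ x, V x * toL2 (u t) x * toL2 φ x)
        + inner ℝ (timeDeriv u t) (toL2 φ))) t

/-- The total energy `E(t) = ½ ∫ (|u_t|² + |∇u|² + V |u|²) dx`. -/
def energy {n : ℕ} (V : Space n →ᵇ ℝ) (u : ℝ → H1 n) (t : ℝ) : ℝ :=
  1 / 2 * ∫ x, (|timeDeriv u t x| ^ 2 + ‖grad (u t) x‖ ^ 2 + V x * |toL2 (u t) x| ^ 2)

/-- The support of a class `f ∈ L²(ℝⁿ)`: the complement of the largest open set on which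
`f = 0` almost everywhere. -/
def essSupport {n : ℕ} (f : L2 n) : Set (Space n) :=
  {x | ∀ U : Set (Space n), IsOpen U → x ∈ U → ¬ ∀ᵐ y : Space n, y ∈ U → f y = 0}

end DampedWave

end

noncomputable section

namespace DampedWave

/-! ### Damped wave equations in Hilbert space. -/

section Abstract

/-! Write `a` for the form `∫ (∇f·∇g + V f g)`. Testing the equation with `u_t` gives `E' =
-‖u_t‖²`, and testing with `u` gives `((u_t, u) + ‖u‖²/2)' = ‖u_t‖² - a(u, u)`. A combination with
weights of order `t²` and `t` (`lyapunov`) dominates both quantities to be bounded and grows by at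
most `∫₀ᵗ ‖u‖²`, so everything rests on a bound for that integral that is uniform in `t`
(`integral_norm_sq_le`).

For this bound, put `v(t) = ∫₀ᵗ u`. Integrating the equation in time and testing with `u = v'` gives
`‖u‖²/2 + a(v, v)/2 + ∫₀ᵗ ‖u‖² = ‖u₀‖²/2 + (u₁ + u₀, v)`. Since `u₁ + u₀` vanishes off `Ω`, Young's
inequality with weight `V` bounds the last term by `L₀²/2 + a(v, v)/2`, and `a(v, v)` cancels. No
Poincaré or Hardy inequality enters, so the constant does not depend on `n`.

As `u_t` is only in `L²`, it is not an admissible test function; the energy argument is run on time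
averages of `u`, whose derivatives are in `H¹`, and then passed to the limit. -/

lemma le_of_hasDerivAt_nonpos {f f' : ℝ → ℝ} (hf : Continuous f)
    (hd : ∀ t, 0 < t → HasDerivAt f (f' t) t) (hle : ∀ t, 0 < t → f' t ≤ 0)
    {t : ℝ} (ht : 0 ≤ t) : f t ≤ f 0 := by
  have h : AntitoneOn f (Ici 0) := by
    refine antitoneOn_of_deriv_nonpos (convex_Ici 0) hf.continuousOn ?_ ?_
    · intro s hs
      rw [interior_Ici] at hs
      exact (hd s hs).differentiableAt.differentiableWithinAt
    · intro s hs
      rw [interior_Ici] at hs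
      rw [(hd s hs).deriv]
      exact hle s hs
  exact h self_mem_Ici ht ht

lemma eq_of_hasDerivAt_zero {f : ℝ → ℝ} (hf : Continuous f)
    (hd : ∀ t, 0 < t → HasDerivAt f 0 t) {t : ℝ} (ht : 0 ≤ t) : f t = f 0 := by
  refine le_antisymm (le_of_hasDerivAt_nonpos hf hd (fun _ _ => le_rfl) ht) ?_
  have := le_of_hasDerivAt_nonpos hf.neg (fun s hs => (hd s hs).neg) (fun _ _ => by simp) ht
  simpa using this

variable {X H : Type*} [NormedAddCommGroup X] [NormedSpace ℝ X]
  [NormedAddCommGroup H] [InnerProductSpace ℝ H]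

/-- `u` with `(j u)' = w` solves `⟪w, j φ⟫' + a(u, φ) + ⟪w, j φ⟫ = 0` on `(0, ∞)`. -/
structure IsAbstractSolution (j : X →L[ℝ] H) (a : X →L[ℝ] X →L[ℝ] ℝ) (u : ℝ → X)
    (w : ℝ → H) : Prop where
  continuous : Continuous u
  continuous_deriv : Continuous w
  hasDerivAt : ∀ t, 0 < t → HasDerivAt (fun s => j (u s)) (w t) t
  equation : ∀ φ t, 0 < t →
    HasDerivAt (fun s => inner ℝ (w s) (j φ)) (-(a (u t) φ + inner ℝ (w t) (j φ))) t

/-- A weighted combination of the energy `(‖y‖² + a(x, x)) / 2` and of `⟪y, j x⟫ + ‖j x‖² / 2`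
that grows at most like `∫ ‖j x‖²` along solutions of the damped wave equation. -/
def lyapunov (j : X →L[ℝ] H) (a : X →L[ℝ] X →L[ℝ] ℝ) (t : ℝ) (x : X) (y : H) : ℝ :=
  ((1 + t) ^ 2 + 2 * (1 + t) + 5 / 2) * ((‖y‖ ^ 2 + a x x) / 2)
    + (2 + t) * (inner ℝ y (j x) + ‖j x‖ ^ 2 / 2)

variable {j : X →L[ℝ] H} {a : X →L[ℝ] X →L[ℝ] ℝ}

lemma continuous_lyapunov {T : Type*} [TopologicalSpace T] {t : T → ℝ} {x : T → X} {y : T → H}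
    (ht : Continuous t) (hx : Continuous x) (hy : Continuous y) :
    Continuous (fun s => lyapunov j a (t s) (x s) (y s)) := by
  unfold lyapunov
  have hj : Continuous fun s => j (x s) := by fun_prop
  have hi : Continuous fun s => inner ℝ (y s) (j (x s)) := hy.inner hj
  have ha : Continuous fun s => a (x s) (x s) := by fun_prop
  fun_prop

/-- The cross term is at least `-‖y‖² - ‖j x‖²/4`; the lower-order part of the energy weight absorbs
the loss `(2 + t)‖y‖²`. -/
lemma le_lyapunov (ha : ∀ x, 0 ≤ a x x) {t : ℝ} (ht : 0 ≤ t) (x : X) (y : H) :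
    (1 + t) ^ 2 * ((‖y‖ ^ 2 + a x x) / 2) + (1 + t) * (‖j x‖ ^ 2 / 4) ≤ lyapunov j a t x y := by
  have h := real_inner_self_nonneg (F := H) (x := y + (1 / 2 : ℝ) • j x)
  rw [inner_add_add_self, inner_smul_left, inner_smul_right, inner_smul_left, inner_smul_right,
    real_inner_self_eq_norm_sq, real_inner_self_eq_norm_sq, real_inner_comm y (j x)] at h
  simp only [conj_trivial] at h
  have hp : 0 ≤ inner ℝ y (j x) + ‖j x‖ ^ 2 / 4 + ‖y‖ ^ 2 := by linarith
  have := ha x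
  have h1 : 0 ≤ (2 + t) * (inner ℝ y (j x) + ‖j x‖ ^ 2 / 4 + ‖y‖ ^ 2) := by positivity
  have h2 : 0 ≤ (2 * (1 + t) + 5 / 2) * a x x := by positivity
  have h3 : 0 ≤ ‖y‖ ^ 2 := by positivity
  have h4 : 0 ≤ ‖j x‖ ^ 2 := by positivity
  unfold lyapunov
  linarith

lemma lyapunov_zero_le (x : X) (y : H) :
    lyapunov j a 0 x y ≤ 15 / 4 * ‖y‖ ^ 2 + 11 / 4 * a x x + 2 * ‖j x‖ ^ 2 := by
  have h := real_inner_self_nonneg (F := H) (x := y - j x)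
  rw [inner_sub_sub_self, real_inner_self_eq_norm_sq, real_inner_self_eq_norm_sq,
    real_inner_comm y (j x)] at h
  unfold lyapunov
  linarith

/-- Here `y = j z'` with `z'` in `X`, so testing with `z'` is legitimate. Half the derivative of the
energy weight equals `2 + t`, so the `a(z, z)` terms cancel in the derivative of `lyapunov`. -/
lemma lyapunov_le_of_regular (hsymm : ∀ x y, a x y = a y x)
    {z z' : ℝ → X} {y q : ℝ → H} (hz : Continuous z) (hy : Continuous y)
    (hzd : ∀ t, 0 < t → HasDerivAt z (z' t) t) (hyz : ∀ t, 0 < t → y t = j (z' t))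
    (hyd : ∀ t, 0 < t → HasDerivAt y (q t) t)
    (heq : ∀ φ t, 0 < t → inner ℝ (q t) (j φ) + a (z t) φ + inner ℝ (y t) (j φ) = 0)
    {t : ℝ} (ht : 0 ≤ t) :
    lyapunov j a t (z t) (y t)
      ≤ lyapunov j a 0 (z 0) (y 0) + ∫ s in (0 : ℝ)..t, ‖j (z s)‖ ^ 2 := by
  have hN : Continuous fun s => ‖j (z s)‖ ^ 2 := by fun_prop
  suffices h : lyapunov j a t (z t) (y t) - ∫ s in (0 : ℝ)..t, ‖j (z s)‖ ^ 2
      ≤ lyapunov j a 0 (z 0) (y 0) - ∫ s in (0 : ℝ)..0, ‖j (z s)‖ ^ 2 by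
    rw [intervalIntegral.integral_same] at h
    linarith
  have hI : ∀ s, HasDerivAt (fun s => ∫ r in (0 : ℝ)..s, ‖j (z r)‖ ^ 2) (‖j (z s)‖ ^ 2) s :=
    fun s => hN.integral_hasStrictDerivAt 0 s |>.hasDerivAt
  refine le_of_hasDerivAt_nonpos
    (f := fun t => lyapunov j a t (z t) (y t) - ∫ s in (0 : ℝ)..t, ‖j (z s)‖ ^ 2)
    (f' := fun t => (2 * (1 + t) + 2) * ((‖y t‖ ^ 2 + a (z t) (z t)) / 2)
      + ((1 + t) ^ 2 + 2 * (1 + t) + 5 / 2) * (-‖y t‖ ^ 2)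
      + ((inner ℝ (y t) (j (z t)) + ‖j (z t)‖ ^ 2 / 2)
      + (2 + t) * (‖y t‖ ^ 2 - a (z t) (z t))) - ‖j (z t)‖ ^ 2) ?_ ?_ ?_ ht
  · exact (continuous_lyapunov continuous_id hz hy).sub
      (continuous_iff_continuousAt.2 fun s => (hI s).continuousAt)
  · intro s hs
    have hjz : HasDerivAt (fun s => j (z s)) (y s) s := by
      rw [hyz s hs]; exact j.hasFDerivAt.comp_hasDerivAt s (hzd s hs)
    have e1 := heq (z' s) s hs
    rw [← hyz s hs, real_inner_self_eq_norm_sq] at e1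
    have e2 := heq (z s) s hs
    have hA : HasDerivAt (fun s => a (z s) (z s)) (2 * a (z s) (z' s)) s := by
      have := a.hasDerivAt_of_bilinear (fun _ => hzd s hs) (fun _ => hzd s hs)
      rw [hsymm (z' s)] at this
      exact this.congr_deriv (by ring)
    have hY := (hyd s hs).norm_sq
    have hE : HasDerivAt (fun s => (‖y s‖ ^ 2 + a (z s) (z s)) / 2) (-‖y s‖ ^ 2) s := by
      refine ((hY.add hA).div_const 2).congr_deriv ?_
      rw [real_inner_comm]
      linarith
    have hP : HasDerivAt (fun s => inner ℝ (y s) (j (z s)) + ‖j (z s)‖ ^ 2 / 2)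
        (‖y s‖ ^ 2 - a (z s) (z s)) s := by
      refine (((hyd s hs).inner ℝ hjz).add (hjz.norm_sq.div_const 2)).congr_deriv ?_
      rw [real_inner_self_eq_norm_sq, real_inner_comm (y s) (j (z s))]
      linarith
    have hw1 : HasDerivAt (fun s : ℝ => (1 + s) ^ 2 + 2 * (1 + s) + 5 / 2) (2 * (1 + s) + 2) s := by
      have h1 : HasDerivAt (fun s : ℝ => 1 + s) 1 s := (hasDerivAt_id s).const_add 1
      refine (((h1.pow 2).add (h1.const_mul 2)).add_const (5 / 2)).congr_deriv ?_
      norm_num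
    have hw2 : HasDerivAt (fun s : ℝ => 2 + s) 1 s := (hasDerivAt_id s).const_add 2
    refine (((hw1.mul hE).add (hw2.mul hP)).sub (hI s)).congr_deriv ?_
    ring
  · intro s hs
    have h := real_inner_self_nonneg (F := H) (x := y s - j (z s))
    rw [inner_sub_sub_self, real_inner_self_eq_norm_sq, real_inner_self_eq_norm_sq,
      real_inner_comm (y s) (j (z s))] at h
    -- After Young's inequality on the cross term, what remains is at most `-(s² + 2s + 1)‖y‖²`.
    have h1 : 0 ≤ (s ^ 2 + 2 * s) * ‖y s‖ ^ 2 := by positivity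
    have h2 : 0 ≤ ‖y s‖ ^ 2 := by positivity
    linarith

/-! ### The time-integrated equation, the bound on `∫ ‖j u‖²`, and regularization. -/

namespace IsAbstractSolution

variable {u : ℝ → X} {w : ℝ → H}

lemma continuous_map (h : IsAbstractSolution j a u w) : Continuous fun s => j (u s) :=
  j.continuous.comp h.continuous

variable [CompleteSpace X]

lemma hasDerivAt_primitive (h : IsAbstractSolution j a u w) (t : ℝ) :
    HasDerivAt (fun t => ∫ s in (0 : ℝ)..t, u s) (u t) t :=
  (h.continuous.integral_hasStrictDerivAt 0 t).hasDerivAt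

lemma integrated_equation (h : IsAbstractSolution j a u w) (φ : X) {t : ℝ} (ht : 0 ≤ t) :
    inner ℝ (w t) (j φ) + a (∫ s in (0 : ℝ)..t, u s) φ + inner ℝ (j (u t)) (j φ)
      = inner ℝ (w 0 + j (u 0)) (j φ) := by
  have hv := h.hasDerivAt_primitive
  have hvc : Continuous fun t => ∫ s in (0 : ℝ)..t, u s :=
    continuous_iff_continuousAt.2 fun s => (hv s).continuousAt
  have hav : ∀ t, HasDerivAt (fun t => a (∫ s in (0 : ℝ)..t, u s) φ) (a (u t) φ) t := fun t =>
    (a.flip φ).hasFDerivAt.comp_hasDerivAt t (hv t)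
  have hfc : Continuous fun t => inner ℝ (w t) (j φ) + a (∫ s in (0 : ℝ)..t, u s) φ
      + inner ℝ (j (u t)) (j φ) :=
    ((h.continuous_deriv.inner continuous_const).add
      (continuous_iff_continuousAt.2 fun s => (hav s).continuousAt)).add
      (h.continuous_map.inner continuous_const)
  have := eq_of_hasDerivAt_zero hfc (fun s hs => ?_) ht
  · simpa [inner_add_left] using this
  · have h3 := (h.hasDerivAt s hs).inner ℝ (hasDerivAt_const s (j φ))
    refine (((h.equation φ s hs).add (hav s)).add h3).congr_deriv ?_
    simp

/-- Energy identity for the primitive `v` of `u`: the function `hfc` is constant. The hypothesis on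
`K`, applied to `φ = v t`, cancels `a(v, v)/2`. -/
lemma integral_norm_sq_le (h : IsAbstractSolution j a u w) (hsymm : ∀ x y, a x y = a y x)
    {K : ℝ} (hK : ∀ φ, inner ℝ (w 0 + j (u 0)) (j φ) ≤ K + a φ φ / 2) {t : ℝ} (ht : 0 ≤ t) :
    ∫ s in (0 : ℝ)..t, ‖j (u s)‖ ^ 2 ≤ ‖j (u 0)‖ ^ 2 / 2 + K := by
  set v : ℝ → X := fun t => ∫ s in (0 : ℝ)..t, u s with hv_def
  have hv : ∀ t, HasDerivAt v (u t) t := h.hasDerivAt_primitive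
  have hvc : Continuous v := continuous_iff_continuousAt.2 fun s => (hv s).continuousAt
  have hN : Continuous fun s => ‖j (u s)‖ ^ 2 := h.continuous_map.norm.pow 2
  have hI : ∀ s, HasDerivAt (fun s => ∫ r in (0 : ℝ)..s, ‖j (u r)‖ ^ 2) (‖j (u s)‖ ^ 2) s :=
    fun s => (hN.integral_hasStrictDerivAt 0 s).hasDerivAt
  have hfc : Continuous fun t => ‖j (u t)‖ ^ 2 / 2 + a (v t) (v t) / 2
      - inner ℝ (w 0 + j (u 0)) (j (v t)) + ∫ s in (0 : ℝ)..t, ‖j (u s)‖ ^ 2 := by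
    have h1 : Continuous fun t => a (v t) (v t) := by fun_prop
    have h2 : Continuous fun t => inner ℝ (w 0 + j (u 0)) (j (v t)) :=
      continuous_const.inner (j.continuous.comp hvc)
    exact (((hN.div_const 2).add (h1.div_const 2)).sub h2).add
      (continuous_iff_continuousAt.2 fun s => (hI s).continuousAt)
  have key := eq_of_hasDerivAt_zero hfc (fun s hs => ?_) ht
  · have hv0 : v 0 = 0 := intervalIntegral.integral_same
    simp only [hv0, map_zero, inner_zero_right, intervalIntegral.integral_same] at key
    have := hK (v t)
    have : 0 ≤ ‖j (u t)‖ ^ 2 := by positivity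
    linarith
  · have hA : HasDerivAt (fun s => a (v s) (v s)) (2 * a (v s) (u s)) s := by
      have := a.hasDerivAt_of_bilinear (fun _ => hv s) (fun _ => hv s)
      rw [hsymm (u s)] at this
      exact this.congr_deriv (by ring)
    have hf := (hasDerivAt_const s (w 0 + j (u 0))).inner ℝ
      (j.hasFDerivAt.comp_hasDerivAt s (hv s))
    refine (((((h.hasDerivAt s hs).norm_sq.div_const 2).add (hA.div_const 2)).sub hf).add
      (hI s)).congr_deriv ?_
    have e := h.integrated_equation (u s) hs.le
    rw [real_inner_self_eq_norm_sq, real_inner_comm (j (u s))] at e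
    simp only [inner_zero_left, add_zero]
    linarith

variable [CompleteSpace H]

/-- The mean of `u` over `[t, t + r]` is differentiable in `X`, with the difference quotient of `u`
as derivative. -/
lemma lyapunov_average_le (h : IsAbstractSolution j a u w) (hsymm : ∀ x y, a x y = a y x)
    {r : ℝ} (hr : 0 < r) {t : ℝ} (ht : 0 ≤ t) :
    lyapunov j a t (∫ θ in (0 : ℝ)..1, u (t + r * θ)) (∫ θ in (0 : ℝ)..1, w (t + r * θ))
      ≤ lyapunov j a 0 (∫ θ in (0 : ℝ)..1, u (0 + r * θ)) (∫ θ in (0 : ℝ)..1, w (0 + r * θ))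
        + ∫ s in (0 : ℝ)..t, ‖j (∫ θ in (0 : ℝ)..1, u (s + r * θ))‖ ^ 2 := by
  have hu := h.continuous
  have hw := h.continuous_deriv
  have havg : ∀ s, ∫ θ in (0 : ℝ)..1, u (s + r * θ)
      = r⁻¹ • ((∫ σ in (0 : ℝ)..(s + r), u σ) - ∫ σ in (0 : ℝ)..s, u σ) := fun s => by
    rw [intervalIntegral.integral_comp_add_mul (fun x => u x) hr.ne',
      intervalIntegral.integral_interval_sub_left (hu.intervalIntegrable _ _)
        (hu.intervalIntegrable _ _), mul_zero, mul_one, add_zero]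
  have hjavg : ∀ s, 0 < s → ∫ θ in (0 : ℝ)..1, w (s + r * θ)
      = r⁻¹ • (j (u (s + r)) - j (u s)) := fun s hs => by
    rw [intervalIntegral.integral_comp_add_mul (fun x => w x) hr.ne', mul_zero, mul_one, add_zero,
      intervalIntegral.integral_eq_sub_of_hasDerivAt (f := fun s => j (u s))
        (fun x hx => h.hasDerivAt x ?_) (hw.intervalIntegrable _ _)]
    rw [uIcc_of_le (by linarith)] at hx
    exact hs.trans_le hx.1
  refine lyapunov_le_of_regular hsymm
    (z := fun s => ∫ θ in (0 : ℝ)..1, u (s + r * θ)) (z' := fun s => r⁻¹ • (u (s + r) - u s))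
    (y := fun s => ∫ θ in (0 : ℝ)..1, w (s + r * θ)) (q := fun s => r⁻¹ • (w (s + r) - w s))
    ?_ ?_ ?_ ?_ ?_ ?_ ht
  · exact intervalIntegral.continuous_parametric_intervalIntegral_of_continuous'
      (f := fun s θ => u (s + r * θ)) (by fun_prop) 0 1
  · exact intervalIntegral.continuous_parametric_intervalIntegral_of_continuous'
      (f := fun s θ => w (s + r * θ)) (by fun_prop) 0 1
  · intro s _
    simp only [havg]
    exact (((h.hasDerivAt_primitive (s + r)).comp_add_const s r).sub
      (h.hasDerivAt_primitive s)).const_smul r⁻¹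
  · intro s hs
    simp only [hjavg s hs, map_smul, map_sub]
  · intro s hs
    have := (((h.hasDerivAt (s + r) (by linarith)).comp_add_const s r).sub
      (h.hasDerivAt s hs)).const_smul r⁻¹
    refine this.congr_of_eventuallyEq ?_
    filter_upwards [Ioi_mem_nhds hs] with x hx
    exact hjavg x hx
  · intro φ s hs
    -- The averaged equation is the difference quotient of the integrated one; the initial data
    -- cancel.
    have e1 := h.integrated_equation φ hs.le
    have e2 := h.integrated_equation φ (add_pos hs hr).le
    simp only [havg, hjavg s hs, inner_smul_left, inner_sub_left, map_smul, map_sub,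
      smul_apply, sub_apply, smul_eq_mul, conj_trivial]
    rw [← mul_add, ← mul_add]
    refine mul_eq_zero_of_right _ ?_
    linarith

/-- Limit `r → 0⁺` of the averaged inequality: both sides are continuous in `r`, and at `r = 0` the
averages are the values themselves. -/
lemma lyapunov_le (h : IsAbstractSolution j a u w) (hsymm : ∀ x y, a x y = a y x)
    {t : ℝ} (ht : 0 ≤ t) :
    lyapunov j a t (u t) (w t)
      ≤ lyapunov j a 0 (u 0) (w 0) + ∫ s in (0 : ℝ)..t, ‖j (u s)‖ ^ 2 := by
  have hu := h.continuous
  have hw := h.continuous_deriv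
  have hzc : Continuous fun p : ℝ × ℝ => ∫ θ in (0 : ℝ)..1, u (p.2 + p.1 * θ) :=
    intervalIntegral.continuous_parametric_intervalIntegral_of_continuous'
      (f := fun (p : ℝ × ℝ) θ => u (p.2 + p.1 * θ)) (by fun_prop) 0 1
  have hyc : Continuous fun p : ℝ × ℝ => ∫ θ in (0 : ℝ)..1, w (p.2 + p.1 * θ) :=
    intervalIntegral.continuous_parametric_intervalIntegral_of_continuous'
      (f := fun (p : ℝ × ℝ) θ => w (p.2 + p.1 * θ)) (by fun_prop) 0 1
  have hL : ∀ t : ℝ, Continuous fun r : ℝ => lyapunov j a t (∫ θ in (0 : ℝ)..1, u (t + r * θ))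
      (∫ θ in (0 : ℝ)..1, w (t + r * θ)) := fun t =>
    continuous_lyapunov continuous_const
      (hzc.comp (continuous_id.prodMk continuous_const))
      (hyc.comp (continuous_id.prodMk continuous_const))
  have hR : Continuous fun r : ℝ =>
      ∫ s in (0 : ℝ)..t, ‖j (∫ θ in (0 : ℝ)..1, u (s + r * θ))‖ ^ 2 :=
    intervalIntegral.continuous_parametric_intervalIntegral_of_continuous'
      (f := fun r s => ‖j (∫ θ in (0 : ℝ)..1, u (s + r * θ))‖ ^ 2)
      (by simp only [Function.uncurry_def]; fun_prop) 0 t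
  have hlim := le_of_tendsto_of_tendsto
    (((hL t).tendsto 0).mono_left (nhdsWithin_le_nhds (s := Ioi 0)))
    ((((hL 0).add hR).tendsto 0).mono_left (nhdsWithin_le_nhds (s := Ioi 0)))
    (eventually_nhdsWithin_of_forall fun r hr => h.lyapunov_average_le hsymm hr ht)
  simpa using hlim

theorem decay (h : IsAbstractSolution j a u w) (hsymm : ∀ x y, a x y = a y x)
    (hnonneg : ∀ x, 0 ≤ a x x)
    {K : ℝ} (hK : ∀ φ, inner ℝ (w 0 + j (u 0)) (j φ) ≤ K + a φ φ / 2) {t : ℝ} (ht : 0 ≤ t) :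
    (1 + t) ^ 2 * ((‖w t‖ ^ 2 + a (u t) (u t)) / 2) + (1 + t) * (‖j (u t)‖ ^ 2 / 4)
      ≤ 15 / 4 * ‖w 0‖ ^ 2 + 11 / 4 * a (u 0) (u 0) + 5 / 2 * ‖j (u 0)‖ ^ 2 + K := by
  have h1 := le_lyapunov (j := j) hnonneg ht (u t) (w t)
  have h2 := h.lyapunov_le hsymm ht
  have h3 := lyapunov_zero_le (j := j) (a := a) (u 0) (w 0)
  have h4 := h.integral_norm_sq_le hsymm hK ht
  linarith

end IsAbstractSolution

end Abstract

/-! ### Completeness of `H¹`, which the integrals of `u` in time require. -/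

variable {n : ℕ}

lemma exists_integral_mul_eq_inner {ψ : Space n → ℝ} (hψ : Continuous ψ)
    (hc : HasCompactSupport ψ) :
    ∃ d : L2 n, ∀ f : L2 n, ∫ x, f x * ψ x = inner ℝ d f := by
  have hd : MemLp ψ 2 (volume : Measure (Space n)) := hψ.memLp_of_hasCompactSupport hc
  refine ⟨hd.toLp, fun f => ?_⟩
  rw [L2.inner_def]
  refine integral_congr_ae ?_
  filter_upwards [hd.coeFn_toLp] with x hx
  rw [hx]
  simp

lemma exists_integral_coord_mul_eq_inner {ψ : Space n → ℝ} (hψ : Continuous ψ)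
    (hc : HasCompactSupport ψ) (i : Fin n) :
    ∃ e : L2Vec n, ∀ g : L2Vec n, ∫ x, g x i * ψ x = inner ℝ e g := by
  have he : MemLp (fun x => EuclideanSpace.single i (ψ x)) 2 (volume : Measure (Space n)) := by
    refine Continuous.memLp_of_hasCompactSupport ?_ ?_
    · have : (fun x => EuclideanSpace.single i (ψ x))
          = fun x => ψ x • EuclideanSpace.single i (1 : ℝ) := by
        ext x k
        simp
      rw [this]
      fun_prop
    · exact hc.comp_left (g := fun c : ℝ => (EuclideanSpace.single i c : Space n)) (by simp)
  refine ⟨he.toLp, fun g => ?_⟩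
  rw [L2.inner_def]
  refine integral_congr_ae ?_
  filter_upwards [he.coeFn_toLp] with x hx
  rw [hx, EuclideanSpace.inner_single_left, conj_trivial, mul_comm]

/-- Each identity defining the weak gradient equates two inner products with fixed `L²` elements,
hence is a closed condition. -/
lemma isClosed_H1 (n : ℕ) : IsClosed (H1 n : Set (WithLp 2 (L2 n × L2Vec n))) := by
  have h : (H1 n : Set (WithLp 2 (L2 n × L2Vec n))) = ⋂ (φ : Space n → ℝ) (_ : ContDiff ℝ ∞ φ)
      (_ : HasCompactSupport φ) (i : Fin n),
      {p | ∫ x, p.fst x * fderiv ℝ φ x (EuclideanSpace.single i 1)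
        = - ∫ x, p.snd x i * φ x} := by
    ext p
    simp only [mem_iInter]
    rfl
  rw [h]
  refine isClosed_iInter fun φ => isClosed_iInter fun hφ => isClosed_iInter fun hc =>
    isClosed_iInter fun i => ?_
  obtain ⟨d, hd⟩ := exists_integral_mul_eq_inner
    (continuous_fderiv_apply hφ (EuclideanSpace.single i (1 : ℝ))) (hc.fderiv_apply ℝ _)
  obtain ⟨e, he⟩ := exists_integral_coord_mul_eq_inner hφ.continuous hc i
  simp only [hd, he]
  exact isClosed_eq (continuous_const.inner (WithLp.fstL 2 ℝ (L2 n) (L2Vec n)).continuous)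
    (continuous_const.inner (WithLp.sndL 2 ℝ (L2 n) (L2Vec n)).continuous).neg

instance (n : ℕ) : CompleteSpace (H1 n) := (isClosed_H1 n).completeSpace_coe

/-- The inclusion of `H¹` into `L²`. -/
def toL2L (n : ℕ) : H1 n →L[ℝ] L2 n := (WithLp.fstL 2 ℝ (L2 n) (L2Vec n)).comp (H1 n).subtypeL

/-- The weak gradient as a continuous linear map. -/
def gradL (n : ℕ) : H1 n →L[ℝ] L2Vec n := (WithLp.sndL 2 ℝ (L2 n) (L2Vec n)).comp (H1 n).subtypeL

@[simp] lemma toL2L_apply (f : H1 n) : toL2L n f = toL2 f := rfl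

/-! ### The potential, the form and the energy. -/

lemma memLp_top (V : Space n →ᵇ ℝ) : MemLp V ⊤ (volume : Measure (Space n)) :=
  memLp_top_of_bound V.continuous.aestronglyMeasurable ‖V‖ (.of_forall V.norm_coe_le_norm)

/-- Multiplication by the potential `V` on `L²`. -/
def potential (V : Space n →ᵇ ℝ) : L2 n →L[ℝ] L2 n :=
  (ContinuousLinearMap.mul ℝ ℝ).holderL volume ⊤ 2 2 (memLp_top V).toLp

lemma coeFn_potential (V : Space n →ᵇ ℝ) (f : L2 n) :
    potential V f =ᵐ[volume] fun x => V x * f x := by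
  filter_upwards [(ContinuousLinearMap.mul ℝ ℝ).coeFn_holder (r := 2) (memLp_top V).toLp f,
    (memLp_top V).coeFn_toLp] with x hx hV
  rw [← hV]
  exact hx

lemma inner_potential (V : Space n →ᵇ ℝ) (f g : L2 n) :
    inner ℝ (potential V f) g = ∫ x, V x * f x * g x := by
  rw [L2.inner_def]
  refine integral_congr_ae ?_
  filter_upwards [coeFn_potential V f] with x hx
  rw [hx]
  simp [mul_comm]

lemma integrable_potential_mul_sq (V : Space n →ᵇ ℝ) (f : L2 n) :
    Integrable (fun x => V x * |f x| ^ 2) := by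
  refine (L2.integrable_inner (𝕜 := ℝ) (potential V f) f).congr ?_
  filter_upwards [coeFn_potential V f] with x hx
  rw [hx]
  simp only [RCLike.inner_apply, conj_trivial, sq_abs]
  ring

lemma inner_potential_self (V : Space n →ᵇ ℝ) (f : L2 n) :
    inner ℝ (potential V f) f = ∫ x, V x * |f x| ^ 2 := by
  rw [inner_potential]
  congr with x
  rw [sq_abs]
  ring

/-- The bilinear form `∫ (∇f · ∇g + V f g) dx` on `H¹`. -/
def form (V : Space n →ᵇ ℝ) : H1 n →L[ℝ] H1 n →L[ℝ] ℝ :=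
  (innerSL ℝ).bilinearComp (gradL n) (gradL n)
    + (innerSL ℝ).bilinearComp ((potential V).comp (toL2L n)) (toL2L n)

lemma form_apply (V : Space n →ᵇ ℝ) (f g : H1 n) :
    form V f g = inner ℝ (grad f) (grad g) + inner ℝ (potential V (toL2 f)) (toL2 g) := rfl

lemma form_symm (V : Space n →ᵇ ℝ) (f g : H1 n) : form V f g = form V g f := by
  rw [form_apply, form_apply, real_inner_comm, inner_potential, inner_potential]
  congr 2 with x
  ring

lemma form_self (V : Space n →ᵇ ℝ) (f : H1 n) :
    form V f f = ‖grad f‖ ^ 2 + ∫ x, V x * |toL2 f x| ^ 2 := by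
  rw [form_apply, real_inner_self_eq_norm_sq, inner_potential_self]

lemma form_self_nonneg {V : Space n →ᵇ ℝ} (hV : ∀ x, 0 ≤ V x) (f : H1 n) : 0 ≤ form V f f := by
  rw [form_self]
  have : 0 ≤ ∫ x, V x * |toL2 f x| ^ 2 :=
    integral_nonneg fun x => mul_nonneg (hV x) (by positivity)
  positivity

lemma integrable_norm_sq {E : Type*} [NormedAddCommGroup E] [InnerProductSpace ℝ E]
    (f : Lp E 2 (volume : Measure (Space n))) : Integrable (fun x => ‖f x‖ ^ 2) :=
  (L2.integrable_inner (𝕜 := ℝ) f f).congr 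
    (.of_forall fun x => real_inner_self_eq_norm_sq (f x))

lemma integral_norm_sq {E : Type*} [NormedAddCommGroup E] [InnerProductSpace ℝ E]
    (f : Lp E 2 (volume : Measure (Space n))) : ∫ x, ‖f x‖ ^ 2 = ‖f‖ ^ 2 := by
  rw [← real_inner_self_eq_norm_sq, L2.inner_def]
  simp only [real_inner_self_eq_norm_sq]

lemma form_self_le {V : Space n →ᵇ ℝ} {M : ℝ} (hV : ∀ x, V x ≤ M) (f : H1 n) :
    form V f f ≤ ‖grad f‖ ^ 2 + M * ‖toL2 f‖ ^ 2 := by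
  rw [form_self, ← integral_norm_sq (toL2 f), ← integral_const_mul]
  exact add_le_add le_rfl (integral_mono (integrable_potential_mul_sq V _)
    ((integrable_norm_sq (toL2 f)).const_mul M)
    fun x => mul_le_mul_of_nonneg_right (hV x) (by positivity))

lemma energy_eq (V : Space n →ᵇ ℝ) (u : ℝ → H1 n) (t : ℝ) :
    energy V u t = (‖timeDeriv u t‖ ^ 2 + form V (u t) (u t)) / 2 := by
  have h1 := integrable_norm_sq (timeDeriv u t)
  have h2 := integrable_norm_sq (grad (u t))
  have h3 := integrable_potential_mul_sq V (toL2 (u t))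
  simp only [Real.norm_eq_abs] at h1
  have h12 : Integrable (fun x => |timeDeriv u t x| ^ 2 + ‖grad (u t) x‖ ^ 2) := h1.add h2
  rw [energy, integral_add h12 h3, integral_add h1 h2, integral_norm_sq, form_self,
    ← integral_norm_sq (timeDeriv u t)]
  simp only [Real.norm_eq_abs]
  ring

/-! ### The data `u₁ + u₀` and the weighted Young inequality. -/

lemma ae_eq_zero_of_essSupport_subset {f : L2 n} {F : Set (Space n)} (h : essSupport f ⊆ F) :
    ∀ᵐ x : Space n, x ∉ F → f x = 0 := by
  have : volume {x | x ∉ F ∧ f x ≠ 0} = 0 := by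
    refine measure_null_of_locally_null _ fun x hx => ?_
    have hx' : x ∉ essSupport f := fun hs => hx.1 (h hs)
    simp only [essSupport, mem_ofPred_eq, not_forall, not_not] at hx'
    obtain ⟨U, hU, hxU, hf⟩ := hx'
    refine ⟨U ∩ {x | x ∉ F ∧ f x ≠ 0}, Filter.inter_mem
      (mem_nhdsWithin_of_mem_nhds (hU.mem_nhds hxU)) self_mem_nhdsWithin, ?_⟩
    refine measure_mono_null (fun y hy => ?_) (ae_iff.1 hf)
    exact fun hy' => hy.2.2 (hy' hy.1)
  rw [ae_iff]
  simpa only [Classical.not_imp] using this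

lemma ae_eq_zero_off {f : L2 n} {Ω : Set (Space n)} (hΩ : IsOpen Ω)
    (hs : essSupport f ⊆ closure Ω) (hf : ∀ᵐ x : Space n, x ∈ frontier Ω → f x = 0) :
    ∀ᵐ x : Space n, x ∉ Ω → f x = 0 := by
  filter_upwards [ae_eq_zero_of_essSupport_subset hs, hf] with x h1 h2 hx
  by_cases hc : x ∈ closure Ω
  · exact h2 (hΩ.frontier_eq ▸ ⟨hc, hx⟩)
  · exact h1 hc

lemma inner_le_of_ae_eq_zero_off {V : Space n →ᵇ ℝ} {Ω : Set (Space n)} (hΩ : IsOpen Ω)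
    (hV : ∀ x, 0 ≤ V x) (hVΩ : ∀ x ∈ Ω, 0 < V x) {f : L2 n}
    (hf : ∀ᵐ x : Space n, x ∉ Ω → f x = 0) (hi : IntegrableOn (fun x => |f x| ^ 2 / V x) Ω)
    (g : H1 n) :
    inner ℝ f (toL2 g) ≤ (∫ x in Ω, |f x| ^ 2 / V x) / 2 + form V g g / 2 := by
  have hfg : Integrable (fun x => f x * toL2 g x) := by
    refine (L2.integrable_inner (𝕜 := ℝ) f (toL2 g)).congr (.of_forall fun x => ?_)
    simp [mul_comm]
  have hVg := integrable_potential_mul_sq V (toL2 g)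
  calc inner ℝ f (toL2 g) = ∫ x in Ω, f x * toL2 g x := by
        rw [setIntegral_eq_integral_of_ae_compl_eq_zero, L2.inner_def]
        · congr with x
          simp [mul_comm]
        · filter_upwards [hf] with x hx hxΩ
          rw [hx hxΩ, zero_mul]
    _ ≤ ∫ x in Ω, (|f x| ^ 2 / V x / 2 + V x * |toL2 g x| ^ 2 / 2) := by
        refine setIntegral_mono_on hfg.integrableOn
          ((hi.div_const 2).add (hVg.integrableOn.div_const 2)) hΩ.measurableSet fun x hx => ?_
        have hp := hVΩ x hx
        -- Young's inequality with weight `V`, by completing the square.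
        have : 0 ≤ (f x - V x * toL2 g x) ^ 2 / V x / 2 := by positivity
        have e : (f x - V x * toL2 g x) ^ 2 / V x / 2
            = |f x| ^ 2 / V x / 2 + V x * |toL2 g x| ^ 2 / 2 - f x * toL2 g x := by
          rw [sq_abs, sq_abs]
          field_simp
          ring
        linarith
    _ = (∫ x in Ω, |f x| ^ 2 / V x) / 2 + (∫ x in Ω, V x * |toL2 g x| ^ 2) / 2 := by
        rw [integral_add (hi.div_const 2) (hVg.integrableOn.div_const 2), integral_div,
          integral_div]
    _ ≤ (∫ x in Ω, |f x| ^ 2 / V x) / 2 + form V g g / 2 := by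
        have h1 : ∫ x in Ω, V x * |toL2 g x| ^ 2 ≤ ∫ x, V x * |toL2 g x| ^ 2 :=
          setIntegral_le_integral hVg
            (.of_forall fun x => mul_nonneg (hV x) (by positivity))
        rw [form_self]
        have h2 : 0 ≤ ‖grad g‖ ^ 2 := by positivity
        linarith

/-- Freezing `u` and `u_t` at their initial values for `t < 0` makes them continuous on all of `ℝ`;
the equation is only required for `t > 0`. -/
lemma IsWeakSolution.isAbstractSolution {V : Space n →ᵇ ℝ} {u₀ : H1 n} {u₁ : L2 n}
    {u : ℝ → H1 n} (h : IsWeakSolution V u₀ u₁ u) :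
    IsAbstractSolution (toL2L n) (form V) (fun t => u (max t 0))
      (fun t => timeDeriv u (max t 0)) := by
  have hmax : ∀ t : ℝ, 0 < t → ∀ᶠ s in 𝓝 t, max s 0 = s := fun t ht => by
    filter_upwards [Ioi_mem_nhds ht] with s hs using max_eq_left (le_of_lt hs)
  have hmem : ∀ t : ℝ, max t 0 ∈ Ici (0 : ℝ) := fun t => le_max_right t 0
  refine ⟨h.continuousOn.comp_continuous (by fun_prop) hmem,
    (h.contDiffOn.continuousOn_derivWithin (uniqueDiffOn_Ici 0) le_rfl).comp_continuous
      (by fun_prop) hmem, fun t ht => ?_, fun φ t ht => ?_⟩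
  · rw [max_eq_left ht.le]
    have hd := ((h.contDiffOn.differentiableOn one_ne_zero) t ht.le).hasDerivWithinAt.hasDerivAt
      (Ici_mem_nhds ht)
    refine hd.congr_of_eventuallyEq ?_
    filter_upwards [hmax t ht] with s hs
    rw [hs, toL2L_apply]
  · rw [max_eq_left ht.le, form_apply, inner_potential]
    refine (h.equation φ t ht).congr_of_eventuallyEq ?_
    filter_upwards [hmax t ht] with s hs
    rw [hs, toL2L_apply]

end DampedWave

end

theorem theorem1p4 (M : ℝ) :
    ∃ C : ℝ, 0 < C ∧
      ∀ (n : ℕ), 1 ≤ n →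
      ∀ (Ω : Set (DampedWave.Space n)), IsOpen Ω →
      ∀ (V : DampedWave.Space n →ᵇ ℝ),
        (∀ x, V x ≤ M) → (∀ x, 0 ≤ V x) → (∀ x ∈ Ω, 0 < V x) →
      ∀ (u₀ : DampedWave.H1 n) (u₁ : DampedWave.L2 n),
        DampedWave.essSupport (u₁ + DampedWave.toL2 u₀) ⊆ closure Ω →
        (∀ᵐ x : DampedWave.Space n, x ∈ frontier Ω → (u₁ + DampedWave.toL2 u₀) x = 0) →
        IntegrableOn (fun x => |(u₁ + DampedWave.toL2 u₀) x| ^ 2 / V x) Ω volume →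
      ∀ (u : ℝ → DampedWave.H1 n), DampedWave.IsWeakSolution V u₀ u₁ u →
      ∀ t : ℝ, 0 ≤ t →
        (1 + t) ^ 2 * DampedWave.energy V u t ≤
            C * (‖DampedWave.toL2 u₀‖ ^ 2 + ‖u₁‖ ^ 2 + ‖DampedWave.grad u₀‖ ^ 2
              + ∫ x in Ω, |(u₁ + DampedWave.toL2 u₀) x| ^ 2 / V x) ∧
        (1 + t) * ‖DampedWave.toL2 (u t)‖ ^ 2 ≤
            C * (‖DampedWave.toL2 u₀‖ ^ 2 + ‖u₁‖ ^ 2 + ‖DampedWave.grad u₀‖ ^ 2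
              + ∫ x in Ω, |(u₁ + DampedWave.toL2 u₀) x| ^ 2 / V x) := by
  -- Four times the coefficients in `decay`, because `‖u‖²` enters there with the factor `1/4`; `M`
  -- comes from `a(u₀, u₀) ≤ ‖∇u₀‖² + M‖u₀‖²`.
  refine ⟨15 + 11 * |M|, by positivity, ?_⟩
  intro n _ Ω hΩ V hVM hV hVΩ u₀ u₁ hsupp hfr hint u hu t ht
  have hsol := hu.isAbstractSolution
  have hd := hsol.decay (DampedWave.form_symm V) (DampedWave.form_self_nonneg hV)
    (K := (∫ x in Ω, |(u₁ + DampedWave.toL2 u₀) x| ^ 2 / V x) / 2) ?_ ht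
  · simp only [max_self, max_eq_left ht, hu.initial, hu.initial_deriv,
      DampedWave.toL2L_apply] at hd
    rw [← DampedWave.energy_eq] at hd
    have hE : 0 ≤ DampedWave.energy V u t := by
      rw [DampedWave.energy_eq]
      have := DampedWave.form_self_nonneg hV (u t)
      positivity
    have hA := DampedWave.form_self_le hVM u₀
    have hM : M * ‖DampedWave.toL2 u₀‖ ^ 2 ≤ |M| * ‖DampedWave.toL2 u₀‖ ^ 2 := by
      gcongr
      exact le_abs_self M
    have hL : 0 ≤ ∫ x in Ω, |(u₁ + DampedWave.toL2 u₀) x| ^ 2 / V x :=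
      integral_nonneg fun x => div_nonneg (by positivity) (hV x)
    set N := ‖DampedWave.toL2 u₀‖ ^ 2
    set D := ‖u₁‖ ^ 2
    set G := ‖DampedWave.grad u₀‖ ^ 2
    set L := ∫ x in Ω, |(u₁ + DampedWave.toL2 u₀) x| ^ 2 / V x
    have hN0 : 0 ≤ N := by positivity
    have hD0 : 0 ≤ D := by positivity
    have hG0 : 0 ≤ G := by positivity
    have h1 : 0 ≤ (1 + t) ^ 2 * DampedWave.energy V u t := by positivity
    have h2 : 0 ≤ (1 + t) * ‖DampedWave.toL2 (u t)‖ ^ 2 := by positivity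
    have h3 : 0 ≤ |M| * (D + G + L) := by positivity
    have h4 : 0 ≤ |M| * N := by positivity
    constructor <;> linarith
  · intro φ
    simp only [max_self, hu.initial, hu.initial_deriv, DampedWave.toL2L_apply]
    exact DampedWave.inner_le_of_ae_eq_zero_off hΩ hV hVΩ
      (DampedWave.ae_eq_zero_off hΩ hsupp hfr) hint φ
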